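/- Let $N\ge 0$, let $f(h,t,\theta)\in\mathbb{R}^N$ be defined for $h\in\mathbb{R}^N$, $t\in\mathbb{R}$ and parameters $\theta$, fix $\theta$, let $\gamma\in\mathbb{R}$ and $t_0<T$, and let $(h,m):[t_0,T]\to\mathbb{R}^N\times\mathbb{R}^N$ be a solution of the first-order heavy ball system $$h'(t)=m(t),\qquad m'(t)=-\gamma m(t)+f(h(t),t,\theta),\qquad t\in[t_0,T].$$ Let $\mathcal L:\mathbb{R}^N\times\mathbb{R}^N\to\mathbb{R}$ be a loss that is differentiable at $(h(T),m(T))$ (it may depend on its first argument only). For $t\in[t_0,T]$ and a state $z$, let $\mathcal L_t(z)$ be the value of $\mathcal L$ at the terminal state, at time $T$, of the solution of the system on $[t,T]$ that is in the state $z$ at time $t$. The adjoint states are the row vectors $a_h(t)=\partial\mathcal L/\partial h(t)$ and $a_m(t)=\partial\mathcal L/\partial m(t)$, that is, the partial derivatives of $\mathcal L_t$ with respect to the two components of the state, taken at $(h(t),m(t))$. Derivatives in $t$ on $[t_0,T]$ are one-sided at the end points. (1) Suppose that $f(\cdot,\cdot,\theta)$ is continuous on $\mathbb{R}^N\times[t_0,T]$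 and has there a continuous partial derivative $\partial f/\partial h$ (in particular, that $f$ is $C^1$). Then for every $t\in[t_0,T]$ the system is uniquely solvable on $[t,T]$ from every state near $(h(t),m(t))$ at time $t$, $\mathcal L_t$ is differentiable at $(h(t),m(t))$, and $$a_h'(t)=-a_m(t)\,\frac{\partial f}{\partial h}(h(t),t,\theta),\qquad a_m'(t)=-a_h(t)+\gamma a_m(t).$$ Consequently $a_m$ and $\tilde a_m:=a_m'$ satisfy for every $t\in[t_0,T]$ the heavy ball system $$a_m'(t)=\tilde a_m(t),\qquad \tilde a_m'(t)=a_m(t)\,\frac{\partial f}{\partial h}(h(t),t,\theta)+\gamma\tilde a_m(t),$$ and $a_h(t)=\gamma a_m(t)-\tilde a_m(t)$. (2) Suppose instead only that $f(x,t,\theta)$ is continuous in $t\in[t_0,T]$ for each $x$, that it is Lipschitz in $x$ on every bounded set, uniformly in $t\in[t_0,T]$, and that for almost every $t\in[t_0,T]$ the map $f(\cdot,t,\theta)$ is differentiable at $h(t)$. Then the same unique solvability and differentiability hold for every $t\in[t_0,T]$; $a_h$, $a_m$ and $\tilde a_m=a_m'$ are Lipschitz on $[t_0,T]$; the equations $a_m'=-a_h+\gamma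 a_m=\tilde a_m$ and $a_h=\gamma a_m-\tilde a_m$ hold at every $t\in[t_0,T]$; and the equations $a_h'=-a_m\,\frac{\partial f}{\partial h}(h(t),t,\theta)$ and $\tilde a_m'=a_m\,\frac{\partial f}{\partial h}(h(t),t,\theta)+\gamma\tilde a_m$ hold at almost every $t\in[t_0,T]$. -/

import Mathlib

open Set Filter Topology MeasureTheory

noncomputable section

/-- `(h, m)` solves the first-order heavy ball system `h' = m`, `m' = -γ m + f(h, s, θ)` on the
time interval `[a, b]` (one-sided derivatives at the end points). -/
def IsHBSolution {N : ℕ} {Θ : Type*}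
    (f : EuclideanSpace ℝ (Fin N) → ℝ → Θ → EuclideanSpace ℝ (Fin N)) (γ : ℝ) (θ : Θ) (a b : ℝ)
    (h m : ℝ → EuclideanSpace ℝ (Fin N)) : Prop :=
  ∀ s ∈ Icc a b,
    HasDerivWithinAt h (m s) (Icc a b) s ∧
    HasDerivWithinAt m (-(γ • m s) + f (h s) s θ) (Icc a b) s

/-- The pair `u = (h, m)` solves the heavy ball system on `[t, T]` and starts, at time `t`, in the
state `z`. -/
def IsHBSolutionFrom {N : ℕ} {Θ : Type*}
    (f : EuclideanSpace ℝ (Fin N) → ℝ → Θ → EuclideanSpace ℝ (Fin N)) (γ : ℝ) (θ : Θ) (t T : ℝ)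
    (z : EuclideanSpace ℝ (Fin N) × EuclideanSpace ℝ (Fin N))
    (u : ℝ → EuclideanSpace ℝ (Fin N) × EuclideanSpace ℝ (Fin N)) : Prop :=
  IsHBSolution f γ θ t T (fun s => (u s).1) (fun s => (u s).2) ∧ u t = z

/-- The system is uniquely solvable on `[t, T]` from the state `z` at time `t`. -/
def HBWellPosedFrom {N : ℕ} {Θ : Type*}
    (f : EuclideanSpace ℝ (Fin N) → ℝ → Θ → EuclideanSpace ℝ (Fin N)) (γ : ℝ) (θ : Θ) (t T : ℝ)
    (z : EuclideanSpace ℝ (Fin N) × EuclideanSpace ℝ (Fin N)) : Prop :=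
  (∃ u, IsHBSolutionFrom f γ θ t T z u) ∧
  ∀ u v, IsHBSolutionFrom f γ θ t T z u → IsHBSolutionFrom f γ θ t T z v → EqOn u v (Icc t T)

open Classical in
/-- The terminal state `(h(T), m(T))` of the solution that is in the state `z` at time `t`
(the default value `z` is used only where there is no such solution). -/
def hbTerminalState {N : ℕ} {Θ : Type*}
    (f : EuclideanSpace ℝ (Fin N) → ℝ → Θ → EuclideanSpace ℝ (Fin N)) (γ : ℝ) (θ : Θ) (T t : ℝ)
    (z : EuclideanSpace ℝ (Fin N) × EuclideanSpace ℝ (Fin N)) :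
    EuclideanSpace ℝ (Fin N) × EuclideanSpace ℝ (Fin N) :=
  if H : ∃ u, IsHBSolutionFrom f γ θ t T z u then H.choose T else z

/-- The loss as a function of the state `z = (h(t), m(t))` at time `t`. -/
def hbLoss {N : ℕ} {Θ : Type*}
    (f : EuclideanSpace ℝ (Fin N) → ℝ → Θ → EuclideanSpace ℝ (Fin N)) (γ : ℝ) (θ : Θ) (T : ℝ)
    (L : EuclideanSpace ℝ (Fin N) × EuclideanSpace ℝ (Fin N) → ℝ) (t : ℝ)
    (z : EuclideanSpace ℝ (Fin N) × EuclideanSpace ℝ (Fin N)) : ℝ :=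
  L (hbTerminalState f γ θ T t z)

/-- The adjoint state `a_h(t) = ∂L/∂h(t)` along the trajectory `(h, m)`, a row vector. -/
def adjointH {N : ℕ} {Θ : Type*}
    (f : EuclideanSpace ℝ (Fin N) → ℝ → Θ → EuclideanSpace ℝ (Fin N)) (γ : ℝ) (θ : Θ) (T : ℝ)
    (L : EuclideanSpace ℝ (Fin N) × EuclideanSpace ℝ (Fin N) → ℝ)
    (h m : ℝ → EuclideanSpace ℝ (Fin N)) (t : ℝ) : EuclideanSpace ℝ (Fin N) →L[ℝ] ℝ :=
  fderiv ℝ (fun x => hbLoss f γ θ T L t (x, m t)) (h t)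

/-- The adjoint state `a_m(t) = ∂L/∂m(t)` along the trajectory `(h, m)`, a row vector. -/
def adjointM {N : ℕ} {Θ : Type*}
    (f : EuclideanSpace ℝ (Fin N) → ℝ → Θ → EuclideanSpace ℝ (Fin N)) (γ : ℝ) (θ : Θ) (T : ℝ)
    (L : EuclideanSpace ℝ (Fin N) × EuclideanSpace ℝ (Fin N) → ℝ)
    (h m : ℝ → EuclideanSpace ℝ (Fin N)) (t : ℝ) : EuclideanSpace ℝ (Fin N) →L[ℝ] ℝ :=
  fderiv ℝ (fun p => hbLoss f γ θ T L t (h t, p)) (m t)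

/-- The time derivative of `a_m` on `[t₀, T]` (one-sided at the end points). -/
def adjointMDot {N : ℕ} {Θ : Type*}
    (f : EuclideanSpace ℝ (Fin N) → ℝ → Θ → EuclideanSpace ℝ (Fin N)) (γ : ℝ) (θ : Θ) (t₀ T : ℝ)
    (L : EuclideanSpace ℝ (Fin N) × EuclideanSpace ℝ (Fin N) → ℝ)
    (h m : ℝ → EuclideanSpace ℝ (Fin N)) (t : ℝ) : EuclideanSpace ℝ (Fin N) →L[ℝ] ℝ :=
  derivWithin (adjointM f γ θ T L h m) (Icc t₀ T) t

/-- The Jacobian `∂f/∂h (x, t, θ)`. -/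
def jacH {N : ℕ} {Θ : Type*}
    (f : EuclideanSpace ℝ (Fin N) → ℝ → Θ → EuclideanSpace ℝ (Fin N)) (θ : Θ)
    (x : EuclideanSpace ℝ (Fin N)) (t : ℝ) :
    EuclideanSpace ℝ (Fin N) →L[ℝ] EuclideanSpace ℝ (Fin N) :=
  fderiv ℝ (fun y => f y t θ) x

/-- The adjoint states are well defined on `[t₀, T]`: at each time `t` the system is uniquely
solvable on `[t, T]` from every state near `(h(t), m(t))`, and the loss is a differentiable
function of the state at time `t` there. -/
def AdjointWellDefined {N : ℕ} {Θ : Type*}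
    (f : EuclideanSpace ℝ (Fin N) → ℝ → Θ → EuclideanSpace ℝ (Fin N)) (γ : ℝ) (θ : Θ) (t₀ T : ℝ)
    (L : EuclideanSpace ℝ (Fin N) × EuclideanSpace ℝ (Fin N) → ℝ)
    (h m : ℝ → EuclideanSpace ℝ (Fin N)) : Prop :=
  ∀ t ∈ Icc t₀ T,
    (∀ᶠ z in 𝓝 (h t, m t), HBWellPosedFrom f γ θ t T z) ∧
    DifferentiableAt ℝ (hbLoss f γ θ T L t) (h t, m t)

/-- `f(·, ·, θ)` is continuous on `ℝᴺ × [t₀, T]` and has there a continuous partial derivative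
`∂f/∂h`. -/
def IsC1Field {N : ℕ} {Θ : Type*}
    (f : EuclideanSpace ℝ (Fin N) → ℝ → Θ → EuclideanSpace ℝ (Fin N)) (θ : Θ) (t₀ T : ℝ) : Prop :=
  ContinuousOn (fun q : EuclideanSpace ℝ (Fin N) × ℝ => f q.1 q.2 θ) (univ ×ˢ Icc t₀ T) ∧
  (∀ x, ∀ t ∈ Icc t₀ T, DifferentiableAt ℝ (fun y => f y t θ) x) ∧
  ContinuousOn (fun q : EuclideanSpace ℝ (Fin N) × ℝ => jacH f θ q.1 q.2) (univ ×ˢ Icc t₀ T)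

/-- `f(x, t, θ)` is continuous in `t ∈ [t₀, T]`, and Lipschitz in `x` on every bounded set,
uniformly in `t ∈ [t₀, T]`. -/
def IsLipschitzField {N : ℕ} {Θ : Type*}
    (f : EuclideanSpace ℝ (Fin N) → ℝ → Θ → EuclideanSpace ℝ (Fin N)) (θ : Θ) (t₀ T : ℝ) : Prop :=
  (∀ x, ContinuousOn (fun t => f x t θ) (Icc t₀ T)) ∧
  ∀ R : ℝ, ∃ K : NNReal, ∀ t ∈ Icc t₀ T,
    LipschitzOnWith K (fun x => f x t θ) (Metric.closedBall 0 R)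

end

/-! Write the system as `w' = F(s, w)` on the state space and let `B(s)` be the linearization of `F`
along the given trajectory. Let `U` solve the backward linear equation `U' = -U B`, `U(T) = 1`. The
claim is that `U(t)` is the derivative of the map from the state at time `t` to the terminal state.
If `u` is a neighbouring solution and `d = u - w`, then `(U d)' = U (d' - B d) = U r`, where `r` is
the linearization remainder of `F`. Integration over `[t, T]` gives the error of the first-order
approximation as `∫ U r`. Lipschitz dependence on the initial state gives `r = O(‖d(t)‖)` uniformly
in time, and differentiability of `F` at almost every time gives `r = o(‖d(t)‖)` pointwise, so
dominated convergence makes the error `o(‖d(t)‖)`. No differentiability off the trajectory is needed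
(`IsIntegralCurveOn.hasFDerivAt_flow`).

By the chain rule the adjoint states are the two blocks of the row vector `DL(T) U(t)`. Since `B`
has block rows `(0, 1)` and `(J, -γ)`, the equation `U' = -U B` becomes `a_h' = -a_m J`, `a_m' =
-a_h + γ a_m`. The second equation has a continuous right-hand side and holds everywhere; the first
holds almost everywhere, and everywhere if `J` is continuous (`adjoint_regularity`). Differentiating
the second gives the heavy ball equation for `a_m`.

Coefficients are merely bounded and measurable, so linear equations are used in integrated form
(`exists_continuous_eq_add_integral_mul`), and the product rule rests on absolute continuity
(`apply_sub_apply_eq_integral`). -/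

/-! ### Linear equations with bounded measurable coefficients. -/

/-- A measurable operator-valued function that is bounded by `M` is integrable against a continuous
one on bounded intervals. -/
theorem intervalIntegrable_continuous_mul_bounded {A : Type*} [NormedRing A] [NormedAlgebra ℝ A]
    {U B : ℝ → A} {M : ℝ} (hU : Continuous U) (hBm : StronglyMeasurable B) (hB : ∀ s, ‖B s‖ ≤ M)
    (a b : ℝ) : IntervalIntegrable (fun s => U s * B s) volume a b := by
  refine IntervalIntegrable.continuousOn_mul ?_ hU.continuousOn
  rw [intervalIntegrable_iff]
  have : IsFiniteMeasure ((volume : Measure ℝ).restrict (uIoc a b)) :=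
    ⟨by simp [uIoc]⟩
  exact Integrable.of_bound hBm.aestronglyMeasurable M (Eventually.of_forall hB)

/-- The linear Volterra equation with a bounded measurable coefficient has a continuous solution. -/
theorem exists_continuous_eq_add_integral_mul {A : Type*} [NormedRing A] [NormedAlgebra ℝ A]
    [CompleteSpace A] {B : ℝ → A} {M : ℝ} (hBm : StronglyMeasurable B) (hB : ∀ s, ‖B s‖ ≤ M)
    (c : ℝ) (U₀ : A) :
    ∃ U : ℝ → A, Continuous U ∧ ∀ t, U t = U₀ + ∫ s in c..t, U s * B s := by
  have hM : 0 ≤ M := (norm_nonneg _).trans (hB 0)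
  -- The terms of the Neumann series; their sum is the solution, and the factorial bound below makes
  -- it converge locally uniformly.
  let P : ℕ → ℝ → A := fun n => Nat.rec (fun _ => U₀) (fun _ V t => ∫ s in c..t, V s * B s) n
  have hPs : ∀ n t, P (n + 1) t = ∫ s in c..t, P n s * B s := fun n t => rfl
  have hPc : ∀ n, Continuous (P n) := by
    intro n
    induction n with
    | zero => exact continuous_const
    | succ n ih =>
      exact intervalIntegral.continuous_primitive
        (intervalIntegrable_continuous_mul_bounded ih hBm hB) c
  have hPb : ∀ n t, ‖P n t‖ ≤ ‖U₀‖ * ((M * |t - c|) ^ n / n.factorial) := by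
    intro n
    induction n with
    | zero => intro t; simp [P]
    | succ n ih =>
      intro t
      rw [hPs]
      refine (intervalIntegral.norm_integral_le_abs_of_norm_le
        (g := fun s => ‖U₀‖ * M ^ (n + 1) / n.factorial * |s - c| ^ n)
        (Eventually.of_forall fun s => ?_)
        (Continuous.intervalIntegrable (by fun_prop) _ _)).trans (le_of_eq ?_)
      · calc ‖P n s * B s‖ ≤ ‖P n s‖ * ‖B s‖ := norm_mul_le _ _
          _ ≤ ‖U₀‖ * ((M * |s - c|) ^ n / n.factorial) * M :=
            mul_le_mul (ih s) (hB s) (norm_nonneg _) (by positivity)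
          _ = _ := by rw [mul_pow]; ring
      · rw [intervalIntegral.integral_const_mul, abs_mul, intervalIntegral.abs_intervalIntegral_eq,
          integral_pow_abs_sub_uIoc, abs_of_nonneg (by positivity), abs_of_nonneg (by positivity),
          Nat.factorial_succ, mul_pow]
        push_cast
        field_simp
  have hsum : ∀ R, Summable fun n : ℕ => ‖U₀‖ * ((M * R) ^ n / n.factorial) := fun R =>
    (Real.summable_pow_div_factorial _).mul_left _
  have hPR : ∀ R n, ∀ t ∈ Metric.ball c R,
      ‖P n t‖ ≤ ‖U₀‖ * ((M * R) ^ n / n.factorial) := by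
    intro R n t ht
    refine (hPb n t).trans ?_
    have : |t - c| ≤ R := by simpa [Real.dist_eq] using (Metric.mem_ball.1 ht).le
    gcongr
  have hS : ∀ t, Summable fun n => P n t := fun t =>
    Summable.of_norm_bounded (hsum _) (hPb · t)
  have hUc : Continuous fun t => ∑' n, P n t := by
    rw [continuous_iff_continuousAt]
    intro t
    exact (continuousOn_tsum (fun n => (hPc n).continuousOn) (hsum (|t - c| + 1))
      (hPR (|t - c| + 1))).continuousAt (Metric.isOpen_ball.mem_nhds
        (by simp [Real.dist_eq]))
  refine ⟨_, hUc, fun t => ?_⟩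
  have h1 : HasSum (fun n => ∫ s in c..t, P n s * B s) (∫ s in c..t, (∑' n, P n s) * B s) := by
    refine intervalIntegral.hasSum_integral_of_dominated_convergence
      (fun n _ => ‖U₀‖ * ((M * |t - c|) ^ n / n.factorial) * M)
      (fun n => ((hPc n).stronglyMeasurable.mul hBm).aestronglyMeasurable)
      (fun n => Eventually.of_forall fun s hs => ?_)
      (Eventually.of_forall fun s _ => (hsum _).mul_right _)
      intervalIntegrable_const (Eventually.of_forall fun s _ => ((hS s).hasSum.mul_right _))
    have hst : |s - c| ≤ |t - c| := abs_sub_left_of_mem_uIcc (uIoc_subset_uIcc hs)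
    refine (norm_mul_le _ _).trans (mul_le_mul ((hPb n s).trans ?_) (hB s) (norm_nonneg _)
      (by positivity))
    gcongr
  change ∑' n, P n t = _
  rw [(hS t).tsum_eq_zero_add, ← h1.tsum_eq]
  rfl

/-- The primitive of a function that is bounded by `C` is Lipschitz with constant `C`. -/
theorem lipschitzOnWith_primitive {E : Type*} [NormedAddCommGroup E] [NormedSpace ℝ E]
    {q : ℝ → E} {a b c : ℝ} {C : NNReal} (hc : c ∈ Icc a b) (hq : IntegrableOn q (Icc a b))
    (hC : ∀ s ∈ Icc a b, ‖q s‖ ≤ C) :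
    LipschitzOnWith C (fun t => ∫ s in c..t, q s) (Icc a b) := by
  have hi : ∀ x ∈ Icc a b, ∀ y ∈ Icc a b, IntervalIntegrable q volume x y := fun x hx y hy =>
    (hq.mono_set (ordConnected_Icc.uIcc_subset hx hy)).intervalIntegrable
  refine LipschitzOnWith.of_dist_le_mul fun x hx y hy => ?_
  rw [dist_eq_norm, intervalIntegral.integral_interval_sub_left (hi c hc x hx) (hi c hc y hy),
    Real.dist_eq]
  exact intervalIntegral.norm_integral_le_of_norm_le_const fun s hs =>
    hC s (ordConnected_Icc.uIcc_subset hy hx (uIoc_subset_uIcc hs))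

/-- Product rule in integrated form: if `U' = -U B` in the integrated sense and `d` is a
differentiable curve with bounded derivative, then `(U d)' = U (d' - B d)` in the integrated
sense. -/
theorem apply_sub_apply_eq_integral {E : Type*} [NormedAddCommGroup E] [NormedSpace ℝ E]
    [CompleteSpace E] {B U : ℝ → E →L[ℝ] E} {U₀ : E →L[ℝ] E} {M a b : ℝ} {c : ℝ} (hab : a ≤ b)
    (hBm : StronglyMeasurable B) (hB : ∀ s, ‖B s‖ ≤ M) (hU : Continuous U)
    (hUB : ∀ t, U t = U₀ + ∫ s in c..t, U s * -B s) {d d' : ℝ → E}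
    (hd : ∀ s ∈ Icc a b, HasDerivWithinAt d (d' s) (Icc a b) s) (hd' : ContinuousOn d' (Icc a b)) :
    U b (d b) - U a (d a) = ∫ s in a..b, U s (d' s - B s (d s)) := by
  have hdc : ContinuousOn d (Icc a b) := fun s hs => (hd s hs).continuousWithinAt
  obtain ⟨Cu, hCu⟩ := isCompact_Icc.exists_bound_of_continuousOn (hU.continuousOn (s := Icc a b))
  obtain ⟨Cd, hCd⟩ := isCompact_Icc.exists_bound_of_continuousOn hdc
  obtain ⟨Cd', hCd'⟩ := isCompact_Icc.exists_bound_of_continuousOn hd'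
  have ha : a ∈ Icc a b := left_mem_Icc.2 hab
  have hCu0 : 0 ≤ Cu := (norm_nonneg _).trans (hCu a ha)
  have hCd0 : 0 ≤ Cd := (norm_nonneg _).trans (hCd a ha)
  have hCd0' : 0 ≤ Cd' := (norm_nonneg _).trans (hCd' a ha)
  have hM : 0 ≤ M := (norm_nonneg _).trans (hB 0)
  have hint : ∀ x y, IntervalIntegrable (fun s => U s * -B s) volume x y :=
    intervalIntegrable_continuous_mul_bounded hU hBm.neg
      (fun s => (norm_neg (B s)).trans_le (hB s))
  -- Lebesgue differentiation: `B` is only measurable, so `U` is differentiated at almost every time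
  -- only.
  have hUd : ∀ᵐ s, HasDerivAt U (U s * -B s) s := by
    have hloc : LocallyIntegrable fun s => U s * -B s := by
      intro x
      refine ⟨Icc (x - 1) (x + 1), Icc_mem_nhds (by linarith) (by linarith), ?_⟩
      exact (intervalIntegrable_iff_integrableOn_Icc_of_le (by linarith)).1 (hint _ _)
    filter_upwards [LocallyIntegrable.ae_hasDerivAt_integral hloc] with s hs
    exact ((hs c).const_add U₀).congr_of_eventuallyEq (Eventually.of_forall hUB)
  have hUl : ∀ x ∈ Icc a b, ∀ y ∈ Icc a b, ‖U x - U y‖ ≤ Cu * M * |x - y| := by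
    intro x hx y hy
    rw [hUB x, hUB y, add_sub_add_left_eq_sub,
      intervalIntegral.integral_interval_sub_left (hint _ _) (hint _ _)]
    refine intervalIntegral.norm_integral_le_of_norm_le_const fun s hs => ?_
    refine (norm_mul_le _ _).trans (mul_le_mul
      (hCu s (ordConnected_Icc.uIcc_subset hy hx (uIoc_subset_uIcc hs))) ?_ (norm_nonneg _) hCu0)
    rw [norm_neg]; exact hB s
  have hdl : ∀ x ∈ Icc a b, ∀ y ∈ Icc a b, ‖d x - d y‖ ≤ Cd' * |x - y| := fun x hx y hy =>
    (convex_Icc a b).norm_image_sub_le_of_norm_hasDerivWithin_le hd hCd' hy hx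
  have hGl : LipschitzOnWith (Cu * Cd' + Cu * M * Cd).toNNReal (fun s => U s (d s)) (Icc a b) := by
    refine LipschitzOnWith.of_dist_le_mul fun x hx y hy => ?_
    rw [Real.coe_toNNReal _ (by positivity), dist_eq_norm, Real.dist_eq]
    calc ‖U x (d x) - U y (d y)‖ = ‖U x (d x - d y) + (U x - U y) (d y)‖ := by simp
      _ ≤ ‖U x‖ * ‖d x - d y‖ + ‖U x - U y‖ * ‖d y‖ :=
        (norm_add_le _ _).trans (add_le_add ((U x).le_opNorm _) ((U x - U y).le_opNorm _))
      _ ≤ Cu * (Cd' * |x - y|) + Cu * M * |x - y| * Cd := by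
        gcongr
        · exact hCu x hx
        · exact hdl x hx y hy
        · exact hUl x hx y hy
        · exact hCd y hy
      _ = _ := by ring
  set q : ℝ → E := fun s => U s (d' s - B s (d s)) with hq
  have hqb : ∀ s ∈ Icc a b, ‖q s‖ ≤ (Cu * (Cd' + M * Cd)).toNNReal := by
    intro s hs
    rw [Real.coe_toNNReal _ (by positivity)]
    refine ((U s).le_opNorm _).trans (mul_le_mul (hCu s hs) ((norm_sub_le _ _).trans
      (add_le_add (hCd' s hs) (((B s).le_opNorm _).trans
        (mul_le_mul (hB s) (hCd s hs) (norm_nonneg _) hM)))) (norm_nonneg _) hCu0)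
  have hqi : IntegrableOn q (Icc a b) := by
    refine Integrable.of_bound ?_ _ ((ae_restrict_iff' measurableSet_Icc).2
      (Eventually.of_forall hqb))
    have h1 := (hU.continuousOn (s := Icc a b)).aestronglyMeasurable (μ := volume) measurableSet_Icc
    have h2 := hd'.aestronglyMeasurable (μ := volume) measurableSet_Icc
    have h3 := hdc.aestronglyMeasurable (μ := volume) measurableSet_Icc
    have happ : Continuous fun p : (E →L[ℝ] E) × E => p.1 p.2 :=
      continuous_fst.clm_apply continuous_snd
    exact happ.comp_aestronglyMeasurable₂ h1
      (h2.sub (happ.comp_aestronglyMeasurable₂ hBm.aestronglyMeasurable h3))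
  have hIl := lipschitzOnWith_primitive ha hqi hqb
  rw [← uIcc_of_le hab] at hGl hIl
  -- Both terms are Lipschitz, hence absolutely continuous, so a derivative that vanishes almost
  -- everywhere makes their difference constant. The end points are dropped because `d` has only
  -- one-sided derivatives there.
  have hae : ∀ᵐ s, s ∈ uIcc a b →
      HasDerivAt (fun s => U s (d s) - ∫ r in a..s, q r) 0 s := by
    have h₁ : ∀ᵐ s : ℝ, s ≠ a := by simp [ae_iff, measure_singleton]
    have h₂ : ∀ᵐ s : ℝ, s ≠ b := by simp [ae_iff, measure_singleton]
    have hqi' : IntervalIntegrable q volume a b :=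
      (intervalIntegrable_iff_integrableOn_Icc_of_le hab).2 hqi
    filter_upwards [h₁, h₂, hUd, hqi'.ae_hasDerivAt_integral] with s h1 h2 h3 h4 hs
    have h5 := h4 hs a left_mem_uIcc
    rw [uIcc_of_le hab] at hs
    have h6 : HasDerivAt d (d' s) s := (hd s hs).hasDerivAt
      (Icc_mem_nhds (lt_of_le_of_ne hs.1 (Ne.symm h1)) (lt_of_le_of_ne hs.2 h2))
    refine ((h3.clm_apply h6).sub h5).congr_deriv ?_
    change U s (-B s (d s)) + U s (d' s) - U s (d' s - B s (d s)) = 0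
    rw [map_sub, map_neg]
    abel
  obtain ⟨C, hC⟩ := (hGl.absolutelyContinuousOnInterval.sub
    hIl.absolutelyContinuousOnInterval).const_of_ae_hasDerivAt_zero hae
  have e1 := hC a left_mem_uIcc
  have e2 := hC b right_mem_uIcc
  simp only [Pi.sub_apply, intervalIntegral.integral_same, sub_zero] at e1 e2
  rw [e1, ← e2]
  abel

/-! ### Existence, uniqueness and Lipschitz dependence for locally Lipschitz fields. -/

/-- The radial retraction onto the closed ball of radius `R` is `2`-Lipschitz. -/
theorem lipschitzWith_radialRetraction {E : Type*} [NormedAddCommGroup E] [NormedSpace ℝ E]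
    {R : ℝ} (hR : 0 < R) : LipschitzWith 2 fun z : E => (R / max R ‖z‖) • z := by
  refine LipschitzWith.of_dist_le_mul fun x y => ?_
  have hx : 0 < max R ‖x‖ := lt_max_of_lt_left hR
  have hy : 0 < max R ‖y‖ := lt_max_of_lt_left hR
  have h1 : R / max R ‖x‖ ≤ 1 := (div_le_one hx).2 (le_max_left _ _)
  have h2 : |max R ‖y‖ - max R ‖x‖| ≤ ‖x - y‖ := by
    rw [max_comm R, max_comm R, norm_sub_rev]
    exact (abs_max_sub_max_le_abs _ _ _).trans (abs_norm_sub_norm_le y x)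
  rw [dist_eq_norm, dist_eq_norm]
  calc ‖(R / max R ‖x‖) • x - (R / max R ‖y‖) • y‖
      = ‖(R / max R ‖x‖) • (x - y) + (R / max R ‖x‖ - R / max R ‖y‖) • y‖ := by
        rw [smul_sub, sub_smul]; congr 1; abel
    _ ≤ ‖x - y‖ + ‖x - y‖ := by
        refine (norm_add_le _ _).trans (add_le_add ?_ ?_)
        · rw [norm_smul, Real.norm_of_nonneg (by positivity)]
          exact mul_le_of_le_one_left (norm_nonneg _) h1
        · have e : R / max R ‖x‖ - R / max R ‖y‖
              = (R / max R ‖x‖) * ((max R ‖y‖ - max R ‖x‖) / max R ‖y‖) := by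
            field_simp
          rw [e, norm_smul, norm_mul, norm_div (_ - _), Real.norm_of_nonneg (div_nonneg hR.le hx.le),
            Real.norm_of_nonneg hy.le, Real.norm_eq_abs]
          calc R / max R ‖x‖ * (|max R ‖y‖ - max R ‖x‖| / max R ‖y‖) * ‖y‖
              ≤ 1 * (|max R ‖y‖ - max R ‖x‖| / max R ‖y‖) * max R ‖y‖ := by
                gcongr
                exact le_max_right _ _
            _ = |max R ‖y‖ - max R ‖x‖| := by field_simp
            _ ≤ _ := h2
    _ = _ := by push_cast; ring

theorem norm_radialRetraction_le {E : Type*} [NormedAddCommGroup E] [NormedSpace ℝ E]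
    {R : ℝ} (hR : 0 < R) (z : E) : ‖(R / max R ‖z‖) • z‖ ≤ R := by
  have hz : 0 < max R ‖z‖ := lt_max_of_lt_left hR
  rw [norm_smul, Real.norm_of_nonneg (by positivity), div_mul_eq_mul_div, div_le_iff₀ hz]
  gcongr
  exact le_max_right _ _

theorem radialRetraction_eq_self {E : Type*} [NormedAddCommGroup E] [NormedSpace ℝ E]
    {R : ℝ} (hR : 0 < R) {z : E} (hz : ‖z‖ ≤ R) : (R / max R ‖z‖) • z = z := by
  rw [max_eq_left hz, div_self hR.ne', one_smul]

theorem IsIntegralCurveOn.hasDerivWithinAt_Ici {E : Type*} [NormedAddCommGroup E]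
    [NormedSpace ℝ E] {F : ℝ → E → E} {u : ℝ → E} {a b t : ℝ}
    (hu : IsIntegralCurveOn u F (Icc a b)) (ht : t ∈ Ico a b) :
    HasDerivWithinAt u (F t (u t)) (Ici t) t :=
  (hu t (Ico_subset_Icc_self ht)).mono_of_mem_nhdsWithin (Icc_mem_nhdsGE_of_mem ht)

/-- Integral curves of a locally Lipschitz field are determined by their initial value. -/
theorem IsIntegralCurveOn.eqOn_Icc_of_locallyLipschitz {E : Type*} [NormedAddCommGroup E]
    [NormedSpace ℝ E] {F : ℝ → E → E}
    (hFl : ∀ R : ℝ, ∃ K : NNReal, ∀ s, LipschitzOnWith K (F s) (Metric.closedBall 0 R))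
    {a b : ℝ} {u v : ℝ → E} (hu : IsIntegralCurveOn u F (Icc a b))
    (hv : IsIntegralCurveOn v F (Icc a b)) (h : u a = v a) : EqOn u v (Icc a b) := by
  obtain ⟨Cu, hCu⟩ := isCompact_Icc.exists_bound_of_continuousOn hu.continuousOn
  obtain ⟨Cv, hCv⟩ := isCompact_Icc.exists_bound_of_continuousOn hv.continuousOn
  obtain ⟨K, hK⟩ := hFl (max Cu Cv)
  refine ODE_solution_unique_of_mem_Icc_right (v := F) (K := K)
    (s := fun _ => Metric.closedBall 0 (max Cu Cv)) (fun t _ => hK t) hu.continuousOn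
    (fun t ht => hu.hasDerivWithinAt_Ici ht) (fun t ht => ?_) hv.continuousOn
    (fun t ht => hv.hasDerivWithinAt_Ici ht) (fun t ht => ?_) h
  · simpa using Or.inl (hCu t (Ico_subset_Icc_self ht))
  · simpa using Or.inr (hCv t (Ico_subset_Icc_self ht))

/-- Near an integral curve of a locally Lipschitz field on a compact interval there are integral
curves from all neighbouring initial values, and they depend on these in a Lipschitz way. -/
theorem IsIntegralCurveOn.exists_near {E : Type*} [NormedAddCommGroup E]
    [NormedSpace ℝ E] [CompleteSpace E] {F : ℝ → E → E} (hFc : ∀ z, Continuous fun s => F s z)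
    (hFl : ∀ R : ℝ, ∃ K : NNReal, ∀ s, LipschitzOnWith K (F s) (Metric.closedBall 0 R))
    {a b : ℝ} (hab : a ≤ b) {w : ℝ → E} (hw : IsIntegralCurveOn w F (Icc a b)) :
    ∃ C K : ℝ, ∀ᶠ z in 𝓝 (w a), ∃ u : ℝ → E, u a = z ∧ IsIntegralCurveOn u F (Icc a b) ∧
      ∀ s ∈ Icc a b, ‖u s - w s‖ ≤ C * ‖z - w a‖ ∧
        ‖F s (u s) - F s (w s)‖ ≤ K * ‖u s - w s‖ := by
  obtain ⟨Cw, hCw⟩ := isCompact_Icc.exists_bound_of_continuousOn hw.continuousOn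
  have ha : a ∈ Icc a b := left_mem_Icc.2 hab
  have hCw0 : 0 ≤ Cw := (norm_nonneg _).trans (hCw a ha)
  -- The margin `1` leaves room for neighbouring trajectories. Composing `F` with the retraction `ρ`
  -- onto this ball makes it bounded and globally Lipschitz on `[a, b]` without changing it inside
  -- the ball.
  set R := Cw + 1 with hRdef
  have hR : 0 < R := by positivity
  obtain ⟨K, hK⟩ := hFl R
  obtain ⟨C₀, hC₀⟩ := isCompact_Icc.exists_bound_of_continuousOn
    ((hFc 0).continuousOn (s := Icc a b))
  have hC₀0 : 0 ≤ C₀ := (norm_nonneg _).trans (hC₀ a ha)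
  set ρ : E → E := fun z => (R / max R ‖z‖) • z with hρ
  have hρR : ∀ z, ρ z ∈ Metric.closedBall (0 : E) R := fun z => by
    simpa using norm_radialRetraction_le hR z
  have hGl : ∀ s, LipschitzWith (K * 2) fun z => F s (ρ z) := fun s =>
    lipschitzOnWith_univ.1 ((hK s).comp (lipschitzWith_radialRetraction hR).lipschitzOnWith
      (fun z _ => hρR z))
  have hGb : ∀ s ∈ Icc a b, ∀ z, ‖F s (ρ z)‖ ≤ (C₀ + K * R).toNNReal := by
    intro s hs z
    rw [Real.coe_toNNReal _ (by positivity)]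
    have h1 := (hK s).dist_le_mul _ (hρR z) 0 (by simpa using hR.le)
    rw [dist_eq_norm, dist_zero_right] at h1
    have h2 : ‖ρ z‖ ≤ R := by simpa using hρR z
    calc ‖F s (ρ z)‖ = ‖F s 0 + (F s (ρ z) - F s 0)‖ := by congr 1; abel
      _ ≤ C₀ + K * R := (norm_add_le _ _).trans
        (add_le_add (hC₀ s hs) (h1.trans (by gcongr)))
  have hex : ∀ z, ∃ u : ℝ → E, u a = z ∧ IsIntegralCurveOn u (fun s z => F s (ρ z)) (Icc a b) := by
    intro z
    -- The truncated field is bounded, so a ball of radius bound times length cannot be left during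
    -- `[a, b]`, and one Picard–Lindelöf step covers the interval.
    have hPL : IsPicardLindelof (fun s z => F s (ρ z)) (⟨a, ha⟩ : Icc a b) z
        ((C₀ + K * R).toNNReal * (b - a).toNNReal) 0 (C₀ + K * R).toNNReal (K * 2) := by
      refine ⟨fun s _ => (hGl s).lipschitzOnWith, fun x _ => (hFc _).continuousOn,
        fun s hs x _ => hGb s hs x, ?_⟩
      simp [hab]
    exact hPL.exists_eq_forall_mem_Icc_hasDerivWithinAt₀
  have hwG : IsIntegralCurveOn w (fun s z => F s (ρ z)) (Icc a b) := by
    intro s hs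
    have e : ρ (w s) = w s := radialRetraction_eq_self hR ((hCw s hs).trans (by simp [hRdef]))
    simpa only [e] using hw s hs
  -- The Grönwall factor of the truncated field. Initial values within `C⁻¹` of `w a` give curves
  -- within `1` of `w`; these stay in the ball of radius `R` and therefore solve the original
  -- equation.
  set C : ℝ := Real.exp (K * 2 * (b - a))
  refine ⟨C, K, ?_⟩
  have hCpos : 0 < C := Real.exp_pos _
  filter_upwards [Metric.ball_mem_nhds (w a) (inv_pos.2 hCpos)] with z hz
  obtain ⟨u, hua, hu⟩ := hex z
  have hdist : ∀ s ∈ Icc a b, ‖u s - w s‖ ≤ C * ‖z - w a‖ := by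
    intro s hs
    have h1 := dist_le_of_trajectories_ODE hGl hu.continuousOn
      (fun t ht => hu.hasDerivWithinAt_Ici ht) hwG.continuousOn
      (fun t ht => hwG.hasDerivWithinAt_Ici ht) le_rfl s hs
    rw [dist_eq_norm, dist_eq_norm, hua, mul_comm] at h1
    refine h1.trans ?_
    push_cast
    gcongr
    exact Real.exp_le_exp.2 (by gcongr; exact hs.2)
  have huR : ∀ s ∈ Icc a b, ‖u s‖ ≤ R := by
    intro s hs
    have h1 : ‖z - w a‖ ≤ C⁻¹ := by simpa [dist_eq_norm] using (Metric.mem_ball.1 hz).le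
    have h2 : ‖u s - w s‖ ≤ 1 := (hdist s hs).trans
      ((mul_le_mul_of_nonneg_left h1 hCpos.le).trans_eq (mul_inv_cancel₀ hCpos.ne'))
    calc ‖u s‖ = ‖w s + (u s - w s)‖ := by congr 1; abel
      _ ≤ Cw + 1 := (norm_add_le _ _).trans (add_le_add (hCw s hs) h2)
  refine ⟨u, hua, fun s hs => ?_, fun s hs => ⟨hdist s hs, ?_⟩⟩
  · have e : ρ (u s) = u s := radialRetraction_eq_self hR (huR s hs)
    simpa only [e] using hu s hs
  · have := (hK s).dist_le_mul (u s) (by simpa using huR s hs) (w s)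
      (by simpa using (hCw s hs).trans (by simp [hRdef]))
    simpa [dist_eq_norm] using this

/-! ### Differentiability of the flow. -/

/-- The flow of a field that is differentiable along a trajectory at almost every time is
differentiable at the initial value of that trajectory; its derivative is the solution of the
adjoint linear equation. -/
theorem IsIntegralCurveOn.hasFDerivAt_flow {E : Type*} [NormedAddCommGroup E]
    [NormedSpace ℝ E] [CompleteSpace E] {F : ℝ → E → E}
    (hF : Continuous fun q : ℝ × E => F q.1 q.2) {a b : ℝ} (hab : a ≤ b) {w : ℝ → E}
    (hw : IsIntegralCurveOn w F (Icc a b)) {B U : ℝ → E →L[ℝ] E} {M : ℝ}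
    (hBm : StronglyMeasurable B) (hB : ∀ s, ‖B s‖ ≤ M) (hU : Continuous U)
    (hUB : ∀ t, U t = 1 + ∫ s in b..t, U s * -B s)
    (hwB : ∀ᵐ s, s ∈ Icc a b → HasFDerivAt (F s) (B s) (w s)) {Φ : E → E} {C K : ℝ}
    (hΦ : ∀ᶠ z in 𝓝 (w a), ∃ u : ℝ → E, (u a = z ∧ u b = Φ z) ∧ IsIntegralCurveOn u F (Icc a b) ∧
      ∀ s ∈ Icc a b, ‖u s - w s‖ ≤ C * ‖z - w a‖ ∧
        ‖F s (u s) - F s (w s)‖ ≤ K * ‖u s - w s‖) (hΦw : Φ (w a) = w b) :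
    HasFDerivAt Φ (U a) (w a) := by
  obtain ⟨φ, hφ⟩ := hΦ.choice
  have ha : a ∈ Icc a b := left_mem_Icc.2 hab
  obtain ⟨Cu, hCu⟩ := isCompact_Icc.exists_bound_of_continuousOn (hU.continuousOn (s := Icc a b))
  have hCu0 : 0 ≤ Cu := (norm_nonneg _).trans (hCu a ha)
  have hM : 0 ≤ M := (norm_nonneg _).trans (hB 0)
  have hcomp : ∀ {u : ℝ → E}, ContinuousOn u (Icc a b) →
      ContinuousOn (fun s => F s (u s)) (Icc a b) := fun hu =>
    hF.comp_continuousOn (continuousOn_id.prodMk hu)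
  let r : E → ℝ → E := fun z s => F s (φ z s) - F s (w s) - B s (φ z s - w s)
  have hbound : ∀ᶠ z in 𝓝 (w a), ∀ s ∈ Icc a b, ‖r z s‖ ≤ (|K| + M) * |C| * ‖z - w a‖ := by
    filter_upwards [hφ] with z hz s hs
    obtain ⟨h1, h2⟩ := hz.2.2 s hs
    have h3 : ‖φ z s - w s‖ ≤ |C| * ‖z - w a‖ :=
      h1.trans (mul_le_mul_of_nonneg_right (le_abs_self _) (norm_nonneg _))
    calc ‖r z s‖ ≤ |K| * ‖φ z s - w s‖ + M * ‖φ z s - w s‖ :=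
          (norm_sub_le _ _).trans (add_le_add
            (h2.trans (mul_le_mul_of_nonneg_right (le_abs_self _) (norm_nonneg _)))
            (((B s).le_opNorm _).trans (mul_le_mul_of_nonneg_right (hB s) (norm_nonneg _))))
      _ = (|K| + M) * ‖φ z s - w s‖ := by ring
      _ ≤ (|K| + M) * (|C| * ‖z - w a‖) := by gcongr
      _ = _ := by ring
  -- The product rule applied to `φ z - w`; since `U b = 1`, the boundary terms are exactly the
  -- first-order error of `Φ`.
  have hint : ∀ᶠ z in 𝓝 (w a), Φ z - Φ (w a) - U a (z - w a) = ∫ s in a..b, U s (r z s) := by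
    filter_upwards [hφ] with z ⟨⟨hza, hzb⟩, hz, _⟩
    have h1 := apply_sub_apply_eq_integral hab hBm hB hU hUB
      (d := fun s => φ z s - w s) (d' := fun s => F s (φ z s) - F s (w s))
      (fun s hs => (hz s hs).sub (hw s hs))
      ((hcomp hz.continuousOn).sub (hcomp hw.continuousOn))
    have h2 : U b = 1 := by rw [hUB b]; simp
    simp only [h2, hza, hzb] at h1
    rw [hΦw]
    exact h1
  have hmeas : ∀ᶠ z in 𝓝 (w a), AEStronglyMeasurable (fun s => ‖z - w a‖⁻¹ • U s (r z s))
      (volume.restrict (uIoc a b)) := by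
    filter_upwards [hφ] with z ⟨_, hz, _⟩
    have happ : Continuous fun p : (E →L[ℝ] E) × E => p.1 p.2 :=
      continuous_fst.clm_apply continuous_snd
    have hsub : uIoc a b ⊆ Icc a b := by rw [uIoc_of_le hab]; exact Ioc_subset_Icc_self
    have h1 := (((hcomp hz.continuousOn).sub (hcomp hw.continuousOn)).mono hsub).aestronglyMeasurable
      (μ := volume) measurableSet_uIoc
    have h2 := ((hz.continuousOn.sub hw.continuousOn).mono hsub).aestronglyMeasurable
      (μ := volume) measurableSet_uIoc
    exact (happ.comp_aestronglyMeasurable₂ hU.aestronglyMeasurable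
      (h1.sub (happ.comp_aestronglyMeasurable₂ hBm.aestronglyMeasurable h2))).const_smul _
  have hlim : Tendsto (fun z => ∫ s in a..b, ‖z - w a‖⁻¹ • U s (r z s)) (𝓝 (w a)) (𝓝 0) := by
    rw [show (0 : E) = ∫ s in a..b, (0 : E) by simp]
    refine intervalIntegral.tendsto_integral_filter_of_dominated_convergence
      (fun _ => Cu * ((|K| + M) * |C|)) hmeas ?_ intervalIntegrable_const ?_
    · filter_upwards [hbound] with z hz
      refine Eventually.of_forall fun s hs => ?_
      rw [uIoc_of_le hab] at hs
      have hs' := Ioc_subset_Icc_self hs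
      rw [norm_smul, norm_inv, norm_norm]
      calc ‖z - w a‖⁻¹ * ‖U s (r z s)‖
          ≤ ‖z - w a‖⁻¹ * (Cu * ((|K| + M) * |C| * ‖z - w a‖)) := by
            gcongr
            exact ((U s).le_opNorm _).trans (mul_le_mul (hCu s hs') (hz s hs') (norm_nonneg _) hCu0)
        _ = (‖z - w a‖⁻¹ * ‖z - w a‖) * (Cu * ((|K| + M) * |C|)) := by ring
        -- An inequality, because at `z = w a` the product `0⁻¹ * 0` is `0`.
        _ ≤ 1 * (Cu * ((|K| + M) * |C|)) := by
            gcongr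
            exact inv_mul_le_one
        _ = _ := one_mul _
    · filter_upwards [hwB] with s hs hsab
      rw [uIoc_of_le hab] at hsab
      have hs' := Ioc_subset_Icc_self hsab
      have hO : (fun z => φ z s - w s) =O[𝓝 (w a)] fun z => z - w a :=
        Asymptotics.IsBigO.of_bound C (hφ.mono fun z hz => (hz.2.2 s hs').1)
      have ht : Tendsto (fun z => φ z s) (𝓝 (w a)) (𝓝 (w s)) := by
        rw [tendsto_iff_norm_sub_tendsto_zero]
        refine tendsto_zero_iff_norm_tendsto_zero.1 (hO.trans_tendsto ?_)
        exact tendsto_sub_nhds_zero_iff.2 tendsto_id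
      have ho : (fun z => r z s) =o[𝓝 (w a)] fun z => z - w a :=
        ((hs hs').isLittleO.comp_tendsto ht).trans_isBigO hO
      have ho' : (fun z => U s (r z s)) =o[𝓝 (w a)] fun z => z - w a :=
        ((U s).isBigO_comp _ _).trans_isLittleO ho
      rw [tendsto_zero_iff_norm_tendsto_zero]
      refine ho'.norm_norm.tendsto_div_nhds_zero.congr fun z => ?_
      rw [norm_smul, norm_inv, norm_norm, div_eq_inv_mul]
  rw [hasFDerivAt_iff_tendsto]
  refine (tendsto_zero_iff_norm_tendsto_zero.1 hlim).congr' ?_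
  filter_upwards [hint] with z hz
  rw [hz, intervalIntegral.integral_smul, norm_smul, norm_inv, norm_norm]

/-! ### The heavy ball system as a field on the state space. -/

/-- The right-hand side of the heavy ball system as a time-dependent field on the state space. Its
time argument is clamped to `[t₀, T]`, which makes it a field for all times. -/
noncomputable def hbField {N : ℕ} {Θ : Type*}
    (f : EuclideanSpace ℝ (Fin N) → ℝ → Θ → EuclideanSpace ℝ (Fin N)) (γ : ℝ) (θ : Θ) {t₀ T : ℝ}
    (hT : t₀ ≤ T) (s : ℝ) (z : EuclideanSpace ℝ (Fin N) × EuclideanSpace ℝ (Fin N)) :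
    EuclideanSpace ℝ (Fin N) × EuclideanSpace ℝ (Fin N) :=
  (z.2, -(γ • z.2) + f z.1 (projIcc t₀ T hT s) θ)

/-- The Jacobian of `f` along the curve `h`, with the time clamped to `[t₀, T]`. -/
noncomputable def jacAlong {N : ℕ} {Θ : Type*}
    (f : EuclideanSpace ℝ (Fin N) → ℝ → Θ → EuclideanSpace ℝ (Fin N)) (θ : Θ) {t₀ T : ℝ}
    (hT : t₀ ≤ T) (h : ℝ → EuclideanSpace ℝ (Fin N)) (s : ℝ) :
    EuclideanSpace ℝ (Fin N) →L[ℝ] EuclideanSpace ℝ (Fin N) :=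
  jacH f θ (h (projIcc t₀ T hT s)) (projIcc t₀ T hT s)

/-- The linearization `(x, p) ↦ (p, -γ p + J x)` of the heavy ball field. -/
noncomputable def hbLinearization {N : ℕ} (γ : ℝ)
    (J : EuclideanSpace ℝ (Fin N) →L[ℝ] EuclideanSpace ℝ (Fin N)) :
    EuclideanSpace ℝ (Fin N) × EuclideanSpace ℝ (Fin N) →L[ℝ]
      EuclideanSpace ℝ (Fin N) × EuclideanSpace ℝ (Fin N) :=
  (ContinuousLinearMap.snd ℝ _ _).prod
    (-(γ • ContinuousLinearMap.snd ℝ _ _) + J ∘L ContinuousLinearMap.fst ℝ _ _)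

section

variable {N : ℕ} {Θ : Type*}
  {f : EuclideanSpace ℝ (Fin N) → ℝ → Θ → EuclideanSpace ℝ (Fin N)} {γ : ℝ} {θ : Θ} {t₀ T : ℝ}
  {h m : ℝ → EuclideanSpace ℝ (Fin N)}

theorem isHBSolution_iff_isIntegralCurveOn (hT : t₀ ≤ T) {a b : ℝ} (hab : Icc a b ⊆ Icc t₀ T)
    {u : ℝ → EuclideanSpace ℝ (Fin N) × EuclideanSpace ℝ (Fin N)} :
    IsHBSolution f γ θ a b (fun s => (u s).1) (fun s => (u s).2) ↔
      IsIntegralCurveOn u (hbField f γ θ hT) (Icc a b) := by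
  refine forall₂_congr fun s hs => ?_
  have hp : (projIcc t₀ T hT s : ℝ) = s := by rw [projIcc_of_mem hT (hab hs)]
  constructor
  · rintro ⟨h1, h2⟩
    have := h1.prodMk h2
    simpa only [hbField, hp] using this
  · intro h1
    simp only [hbField, hp] at h1
    exact ⟨h1.fst, h1.snd⟩

/-- The Jacobian is bounded on the compact set ball times `[t₀, T]`, and the mean value inequality
on the convex ball turns this bound into a Lipschitz constant. -/
theorem IsC1Field.isLipschitzField (hf : IsC1Field f θ t₀ T) : IsLipschitzField f θ t₀ T := by
  obtain ⟨h1, h2, h3⟩ := hf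
  refine ⟨fun x => h1.comp (continuousOn_const.prodMk continuousOn_id) fun t ht => ⟨trivial, ht⟩,
    fun R => ?_⟩
  obtain ⟨K, hK⟩ := ((isCompact_closedBall (0 : EuclideanSpace ℝ (Fin N)) R).prod
    (isCompact_Icc (a := t₀) (b := T))).exists_bound_of_continuousOn
      (h3.mono (prod_mono_left (subset_univ _)))
  refine ⟨K.toNNReal, fun t ht => (convex_closedBall _ _).lipschitzOnWith_of_nnnorm_fderiv_le
    (fun x _ => h2 x t ht) fun x hx => ?_⟩
  exact (norm_toNNReal (a := fderiv ℝ (fun y => f y t θ) x)).symm.trans_le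
    (Real.toNNReal_le_toNNReal (hK (x, t) ⟨hx, ht⟩))

theorem IsLipschitzField.exists_lipschitzOnWith_clamped (hf : IsLipschitzField f θ t₀ T)
    (hT : t₀ ≤ T) (R : ℝ) : ∃ K : NNReal, ∀ s,
      LipschitzOnWith K (fun x => f x (projIcc t₀ T hT s) θ) (Metric.closedBall 0 R) :=
  (hf.2 R).imp fun _ hK s => hK _ (projIcc t₀ T hT s).2

theorem IsLipschitzField.continuous_clamped (hf : IsLipschitzField f θ t₀ T) (hT : t₀ ≤ T)
    (x : EuclideanSpace ℝ (Fin N)) : Continuous fun s => f x (projIcc t₀ T hT s) θ :=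
  (hf.1 x).comp_continuous (continuous_subtype_val.comp continuous_projIcc)
    fun s => (projIcc t₀ T hT s).2

/-- A field that is continuous in time and locally Lipschitz in space, uniformly in time, is jointly
continuous. -/
theorem continuous_uncurry_of_locallyLipschitz {E E' : Type*} [NormedAddCommGroup E]
    [NormedAddCommGroup E'] {F : ℝ → E → E'} (hFc : ∀ z, Continuous fun s => F s z)
    (hFl : ∀ R : ℝ, ∃ K : NNReal, ∀ s, LipschitzOnWith K (F s) (Metric.closedBall 0 R)) :
    Continuous (Function.uncurry F) := by
  rw [continuous_iff_continuousAt]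
  rintro ⟨s, z⟩
  obtain ⟨K, hK⟩ := hFl (‖z‖ + 1)
  refine (continuousOn_prod_of_continuousOn_lipschitzOnWith' (s := univ)
    (t := Metric.closedBall 0 (‖z‖ + 1)) (Function.uncurry F) K (fun a _ => hK a)
    (fun b _ => (hFc b).continuousOn)).continuousAt ?_
  exact prod_mem_nhds univ_mem (Metric.closedBall_mem_nhds_of_mem (by simp))

theorem IsLipschitzField.continuous_hbField (hf : IsLipschitzField f θ t₀ T) (hT : t₀ ≤ T)
    (z : EuclideanSpace ℝ (Fin N) × EuclideanSpace ℝ (Fin N)) :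
    Continuous fun s => hbField f γ θ hT s z :=
  continuous_const.prodMk (continuous_const.add (hf.continuous_clamped hT z.1))

theorem IsLipschitzField.exists_lipschitzOnWith_hbField (hf : IsLipschitzField f θ t₀ T)
    (hT : t₀ ≤ T) (R : ℝ) : ∃ K : NNReal, ∀ s,
      LipschitzOnWith K (hbField f γ θ hT s) (Metric.closedBall 0 R) := by
  obtain ⟨K, hK⟩ := hf.exists_lipschitzOnWith_clamped hT R
  refine ⟨max 1 (‖γ‖₊ * 1 + K * 1), fun s => ?_⟩
  have h2 : LipschitzWith 1
      (Prod.snd : EuclideanSpace ℝ (Fin N) × EuclideanSpace ℝ (Fin N) → _) := LipschitzWith.prod_snd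
  have h1 : LipschitzOnWith 1
      (Prod.fst : EuclideanSpace ℝ (Fin N) × EuclideanSpace ℝ (Fin N) → _)
      (Metric.closedBall 0 R) := LipschitzWith.prod_fst.lipschitzOnWith
  refine h2.lipschitzOnWith.prodMk (LipschitzOnWith.add
    (((lipschitzWith_smul γ).comp h2).neg).lipschitzOnWith ((hK s).comp h1 fun z hz => ?_))
  simp only [mem_closedBall_zero_iff] at hz ⊢
  exact (norm_fst_le z).trans hz

theorem IsHBSolution.continuousOn (hsol : IsHBSolution f γ θ t₀ T h m) :
    ContinuousOn h (Icc t₀ T) := fun s hs => (hsol s hs).1.continuousWithinAt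

theorem continuous_clamp {X : Type*} [TopologicalSpace X] {h : ℝ → X} (hT : t₀ ≤ T)
    (hh : ContinuousOn h (Icc t₀ T)) : Continuous fun s => h (projIcc t₀ T hT s) :=
  hh.comp_continuous (continuous_subtype_val.comp continuous_projIcc) fun s => (projIcc t₀ T hT s).2

/-- The spatial `fderiv` of a jointly continuous map is jointly measurable even where it takes its
default value `0`; the Jacobian along `h` is its composition with a continuous curve. -/
theorem IsLipschitzField.stronglyMeasurable_jacAlong (hf : IsLipschitzField f θ t₀ T)
    (hT : t₀ ≤ T) (hh : ContinuousOn h (Icc t₀ T)) :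
    StronglyMeasurable (jacAlong f θ hT h) := by
  have h1 := measurable_fderiv_with_param ℝ (continuous_uncurry_of_locallyLipschitz
    (F := fun s x => f x (projIcc t₀ T hT s) θ) (hf.continuous_clamped hT)
    (hf.exists_lipschitzOnWith_clamped hT))
  exact (h1.comp (continuous_id.prodMk (continuous_clamp hT hh)).measurable).stronglyMeasurable

/-- A local Lipschitz constant bounds `fderiv`, also at times of non-differentiability. The radius
`C + 1` makes the ball a neighbourhood of every point of the curve. -/
theorem IsLipschitzField.exists_norm_jacAlong_le (hf : IsLipschitzField f θ t₀ T)
    (hT : t₀ ≤ T) (hh : ContinuousOn h (Icc t₀ T)) : ∃ K : ℝ, ∀ s, ‖jacAlong f θ hT h s‖ ≤ K := by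
  obtain ⟨C, hC⟩ := isCompact_Icc.exists_bound_of_continuousOn hh
  obtain ⟨K, hK⟩ := hf.exists_lipschitzOnWith_clamped hT (C + 1)
  refine ⟨K, fun s => norm_fderiv_le_of_lipschitzOn ℝ ?_ (hK s)⟩
  refine Metric.closedBall_mem_nhds_of_mem ?_
  rw [mem_ball_zero_iff]
  exact (hC _ (projIcc t₀ T hT s).2).trans_lt (lt_add_one C)

theorem IsC1Field.continuous_jacAlong (hf : IsC1Field f θ t₀ T) (hT : t₀ ≤ T)
    (hh : ContinuousOn h (Icc t₀ T)) : Continuous (jacAlong f θ hT h) :=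
  hf.2.2.comp_continuous (f := fun s => (h (projIcc t₀ T hT s), (projIcc t₀ T hT s : ℝ)))
    ((continuous_clamp hT hh).prodMk (continuous_subtype_val.comp continuous_projIcc))
    fun s => ⟨trivial, (projIcc t₀ T hT s).2⟩

/-- The linearization is affine in the Jacobian. -/
theorem continuous_hbLinearization : Continuous (hbLinearization (N := N) γ) := by
  have e : hbLinearization (N := N) γ = fun J => hbLinearization γ 0 +
      ContinuousLinearMap.inr ℝ _ _ ∘L J ∘L ContinuousLinearMap.fst ℝ _ _ := by
    funext J
    ext z <;> simp [hbLinearization]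
  rw [e]
  exact continuous_const.add (continuous_const.clm_comp (continuous_id.clm_comp continuous_const))

theorem exists_norm_hbLinearization_le (K : ℝ) :
    ∃ M : ℝ, ∀ J : EuclideanSpace ℝ (Fin N) →L[ℝ] EuclideanSpace ℝ (Fin N), ‖J‖ ≤ K →
      ‖hbLinearization γ J‖ ≤ M := by
  obtain ⟨M, hM⟩ := (isCompact_closedBall
    (0 : EuclideanSpace ℝ (Fin N) →L[ℝ] EuclideanSpace ℝ (Fin N)) K).exists_bound_of_continuousOn
      (continuous_hbLinearization (γ := γ)).continuousOn
  exact ⟨M, fun J hJ => hM J (by simpa using hJ)⟩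

theorem hasFDerivAt_hbField (hT : t₀ ≤ T) {s : ℝ} (hs : s ∈ Icc t₀ T)
    (hd : DifferentiableAt ℝ (fun y => f y s θ) (h s)) :
    HasFDerivAt (hbField f γ θ hT s) (hbLinearization γ (jacAlong f θ hT h s)) (h s, m s) := by
  have hp : (projIcc t₀ T hT s : ℝ) = s := by rw [projIcc_of_mem hT hs]
  have h1 : HasFDerivAt (fun y => f y s θ) (jacAlong f θ hT h s) (h s) := by
    simpa only [jacAlong, hp] using! hd.hasFDerivAt
  have h2 := (h1.comp (h s, m s) (hasFDerivAt_fst (𝕜 := ℝ) (p := (h s, m s))))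
  have h3 := hasFDerivAt_snd (𝕜 := ℝ) (p := (h s, m s))
  have h4 := h3.prodMk ((h3.const_smul γ).neg.add h2)
  have e : hbField f γ θ hT s = fun z => (z.2, -(γ • z.2) + f z.1 s θ) := by
    funext z
    simp only [hbField, hp]
  rw [e]
  exact h4

/-- Uniqueness makes the arbitrary choice in `hbTerminalState` immaterial. -/
theorem hbTerminalState_eq {t : ℝ} (htT : t ≤ T)
    {z : EuclideanSpace ℝ (Fin N) × EuclideanSpace ℝ (Fin N)} (hz : HBWellPosedFrom f γ θ t T z)
    {u : ℝ → EuclideanSpace ℝ (Fin N) × EuclideanSpace ℝ (Fin N)}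
    (hu : IsHBSolutionFrom f γ θ t T z u) : hbTerminalState f γ θ T t z = u T := by
  rw [hbTerminalState, dif_pos hz.1]
  exact hz.2 _ _ hz.1.choose_spec hu (right_mem_Icc.2 htT)

/-- The terminal state of the heavy ball system is a differentiable function of the state at time
`t`, and its derivative solves the adjoint linear equation. -/
theorem IsLipschitzField.hasFDerivAt_hbTerminalState (hf : IsLipschitzField f θ t₀ T)
    (hT : t₀ ≤ T) (hsol : IsHBSolution f γ θ t₀ T h m)
    (hd : ∀ᵐ t ∂(volume.restrict (Icc t₀ T)), DifferentiableAt ℝ (fun y => f y t θ) (h t)) :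
    ∃ U : ℝ → EuclideanSpace ℝ (Fin N) × EuclideanSpace ℝ (Fin N) →L[ℝ]
        EuclideanSpace ℝ (Fin N) × EuclideanSpace ℝ (Fin N),
      Continuous U ∧
      (∀ a b, IntervalIntegrable (fun s => U s * -hbLinearization γ (jacAlong f θ hT h s))
        volume a b) ∧
      (∀ t, U t = 1 + ∫ s in T..t, U s * -hbLinearization γ (jacAlong f θ hT h s)) ∧
      ∀ t ∈ Icc t₀ T, (∀ᶠ z in 𝓝 (h t, m t), HBWellPosedFrom f γ θ t T z) ∧
        hbTerminalState f γ θ T t (h t, m t) = (h T, m T) ∧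
        HasFDerivAt (hbTerminalState f γ θ T t) (U t) (h t, m t) := by
  obtain ⟨K, hK⟩ := hf.exists_norm_jacAlong_le hT hsol.continuousOn
  obtain ⟨M, hM⟩ := exists_norm_hbLinearization_le (N := N) (γ := γ) K
  set B := fun s => hbLinearization γ (jacAlong f θ hT h s) with hBdef
  have hBm : StronglyMeasurable B :=
    continuous_hbLinearization.comp_stronglyMeasurable
      (hf.stronglyMeasurable_jacAlong hT hsol.continuousOn)
  have hB : ∀ s, ‖B s‖ ≤ M := fun s => hM _ (hK s)
  have hBn : ∀ s, ‖(-B) s‖ ≤ M := fun s => (norm_neg (B s)).trans_le (hB s)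
  -- The normalization `U T = 1` sits at the terminal time, so one `U` serves all starting times
  -- `t`.
  obtain ⟨U, hU, hUB⟩ := exists_continuous_eq_add_integral_mul hBm.neg hBn T 1
  refine ⟨U, hU, intervalIntegrable_continuous_mul_bounded hU hBm.neg hBn, hUB, fun t ht => ?_⟩
  have hsub : Icc t T ⊆ Icc t₀ T := Icc_subset_Icc_left ht.1
  set F := hbField f γ θ hT with hF
  have hFl : ∀ R : ℝ, ∃ K : NNReal, ∀ s, LipschitzOnWith K (F s) (Metric.closedBall 0 R) :=
    hf.exists_lipschitzOnWith_hbField hT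
  have hFc : ∀ z, Continuous fun s => F s z := hf.continuous_hbField hT
  let w : ℝ → EuclideanSpace ℝ (Fin N) × EuclideanSpace ℝ (Fin N) := fun s => (h s, m s)
  have hw : IsIntegralCurveOn w F (Icc t T) :=
    IsIntegralCurveOn.mono ((isHBSolution_iff_isIntegralCurveOn hT Subset.rfl (u := w)).1 hsol) hsub
  obtain ⟨C, K', hnear⟩ := hw.exists_near hFc hFl ht.2
  have huniq : ∀ z u v, IsHBSolutionFrom f γ θ t T z u → IsHBSolutionFrom f γ θ t T z v →
      EqOn u v (Icc t T) := fun z u v hu hv =>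
    IsIntegralCurveOn.eqOn_Icc_of_locallyLipschitz hFl
      ((isHBSolution_iff_isIntegralCurveOn hT hsub).1 hu.1)
      ((isHBSolution_iff_isIntegralCurveOn hT hsub).1 hv.1) (hu.2.trans hv.2.symm)
  have hwp : ∀ z u, u t = z → IsIntegralCurveOn u F (Icc t T) → IsHBSolutionFrom f γ θ t T z u ∧
      HBWellPosedFrom f γ θ t T z := fun z u huz hu =>
    have hu' : IsHBSolutionFrom f γ θ t T z u :=
      ⟨(isHBSolution_iff_isIntegralCurveOn hT hsub).2 hu, huz⟩
    ⟨hu', ⟨u, hu'⟩, huniq z⟩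
  have hterm : ∀ z u, u t = z → IsIntegralCurveOn u F (Icc t T) →
      hbTerminalState f γ θ T t z = u T := fun z u huz hu =>
    hbTerminalState_eq ht.2 (hwp z u huz hu).2 (hwp z u huz hu).1
  have hwT := hterm (h t, m t) w rfl hw
  refine ⟨hnear.mono fun z ⟨u, huz, hu, _⟩ => (hwp z u huz hu).2, hwT, ?_⟩
  refine hw.hasFDerivAt_flow (continuous_uncurry_of_locallyLipschitz hFc hFl) ht.2 hBm hB hU hUB
    ?_ (hnear.mono fun z ⟨u, huz, hu, hb⟩ => ⟨u, ⟨huz, (hterm z u huz hu).symm⟩, hu, hb⟩) hwT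
  filter_upwards [(ae_restrict_iff' measurableSet_Icc).1 hd] with s hs hst
  exact hasFDerivAt_hbField hT (hsub hst) (hs (hsub hst))

/-! ### The adjoint equations. -/

/-- The adjoint states agree on `[t₀, T]` with continuous functions that satisfy the adjoint
equations in integrated form. -/
theorem IsLipschitzField.exists_adjoint (hf : IsLipschitzField f θ t₀ T)
    (hT : t₀ ≤ T) (hsol : IsHBSolution f γ θ t₀ T h m)
    (hd : ∀ᵐ t ∂(volume.restrict (Icc t₀ T)), DifferentiableAt ℝ (fun y => f y t θ) (h t))
    {L : EuclideanSpace ℝ (Fin N) × EuclideanSpace ℝ (Fin N) → ℝ}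
    (hL : DifferentiableAt ℝ L (h T, m T)) :
    AdjointWellDefined f γ θ t₀ T L h m ∧
    ∃ A P : ℝ → EuclideanSpace ℝ (Fin N) →L[ℝ] ℝ, Continuous A ∧ Continuous P ∧
      EqOn (adjointH f γ θ T L h m) A (Icc t₀ T) ∧ EqOn (adjointM f γ θ T L h m) P (Icc t₀ T) ∧
      (∀ t, A t = A T + ∫ s in T..t, -(P s ∘L jacAlong f θ hT h s)) ∧
      ∀ t, P t = P T + ∫ s in T..t, (-A s + γ • P s) := by
  obtain ⟨U, hU, hUi, hUB, hΦ⟩ := hf.hasFDerivAt_hbTerminalState hT hsol hd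
  set D := fderiv ℝ L (h T, m T) with hD
  have hloss : ∀ t ∈ Icc t₀ T, HasFDerivAt (hbLoss f γ θ T L t) (D ∘L U t) (h t, m t) := by
    intro t ht
    obtain ⟨_, h2, h3⟩ := hΦ t ht
    have h4 : HasFDerivAt L D (hbTerminalState f γ θ T t (h t, m t)) := by
      rw [h2]; exact hL.hasFDerivAt
    exact h4.comp _ h3
  have hcomp : ∀ (V : EuclideanSpace ℝ (Fin N) →L[ℝ]
      EuclideanSpace ℝ (Fin N) × EuclideanSpace ℝ (Fin N)) (t : ℝ),
      D ∘L U t ∘L V = D ∘L U T ∘L V +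
        ∫ s in T..t, D ∘L (U s * -hbLinearization γ (jacAlong f θ hT h s)) ∘L V := by
    intro V t
    have hUT : U T = 1 := by rw [hUB T]; simp
    -- The map `X ↦ D ∘L X ∘L V`, as a continuous linear map, so that it can be moved under the
    -- integral.
    let Ψ := (ContinuousLinearMap.compL ℝ (EuclideanSpace ℝ (Fin N))
      (EuclideanSpace ℝ (Fin N) × EuclideanSpace ℝ (Fin N)) ℝ D) ∘L
      ((ContinuousLinearMap.compL ℝ (EuclideanSpace ℝ (Fin N))
        (EuclideanSpace ℝ (Fin N) × EuclideanSpace ℝ (Fin N))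
        (EuclideanSpace ℝ (Fin N) × EuclideanSpace ℝ (Fin N))).flip V)
    have e := Ψ.intervalIntegral_comp_comm (hUi T t)
    change Ψ (U t) = Ψ (U T) + _
    rw [hUT, hUB t, map_add, ← e]
    rfl
  refine ⟨fun t ht => ⟨(hΦ t ht).1, (hloss t ht).differentiableAt⟩,
    fun t => D ∘L U t ∘L ContinuousLinearMap.inl ℝ _ _,
    fun t => D ∘L U t ∘L ContinuousLinearMap.inr ℝ _ _,
    continuous_const.clm_comp (hU.clm_comp continuous_const),
    continuous_const.clm_comp (hU.clm_comp continuous_const),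
    fun t ht => ?_, fun t ht => ?_, fun t => ?_, fun t => ?_⟩
  · have := HasFDerivAt.comp (g := hbLoss f γ θ T L t) (h t) (hloss t ht)
      (hasFDerivAt_prodMk_left (𝕜 := ℝ) (h t) (m t))
    exact this.fderiv
  · have := HasFDerivAt.comp (g := hbLoss f γ θ T L t) (m t) (hloss t ht)
      (hasFDerivAt_prodMk_right (𝕜 := ℝ) (h t) (m t))
    exact this.fderiv
  · refine (hcomp (ContinuousLinearMap.inl ℝ _ _) t).trans ?_
    congr 1
    refine intervalIntegral.integral_congr fun s _ => ?_
    ext x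
    have e : hbLinearization γ (jacAlong f θ hT h s) (x, 0) = (0, jacAlong f θ hT h s x) := by
      simp [hbLinearization]
    change D (U s (-hbLinearization γ (jacAlong f θ hT h s) (x, 0))) =
      -D (U s (0, jacAlong f θ hT h s x))
    rw [e, map_neg, map_neg]
  · refine (hcomp (ContinuousLinearMap.inr ℝ _ _) t).trans ?_
    congr 1
    refine intervalIntegral.integral_congr fun s _ => ?_
    ext x
    have e : hbLinearization γ (jacAlong f θ hT h s) (0, x) = (x, 0) - γ • (0, x) := by
      simp [hbLinearization]
    change D (U s (-hbLinearization γ (jacAlong f θ hT h s) (0, x))) =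
      -D (U s (x, 0)) + γ • D (U s (0, x))
    rw [e, neg_sub, map_sub, map_sub, map_smul, map_smul]
    abel

end

/-- If `A' = -P J` and `P' = -A + γ P` in the integrated sense with `J` bounded and measurable, then
`A`, `P` and `P'` are Lipschitz on compact intervals, the equation for `A` holds at almost every
time, and that for `P` at every time. -/
theorem adjoint_regularity {X : Type*} [NormedAddCommGroup X] [NormedSpace ℝ X]
    {A P : ℝ → X →L[ℝ] ℝ} {J : ℝ → X →L[ℝ] X} {γ K T : ℝ} (hJm : StronglyMeasurable J)
    (hJ : ∀ s, ‖J s‖ ≤ K) (hA : Continuous A) (hP : Continuous P)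
    (hAJ : ∀ t, A t = A T + ∫ s in T..t, -(P s ∘L J s))
    (hPA : ∀ t, P t = P T + ∫ s in T..t, (-A s + γ • P s)) :
    (∀ t, HasDerivAt P (-A t + γ • P t) t) ∧
    (∀ᵐ t, HasDerivAt A (-(P t ∘L J t)) t) ∧
    (Continuous J → ∀ t, HasDerivAt A (-(P t ∘L J t)) t) ∧
    (∀ a b, a ≤ b → ∃ K, LipschitzOnWith K A (Icc a b)) ∧
    (∀ a b, a ≤ b → ∃ K, LipschitzOnWith K P (Icc a b)) := by
  have hPd : ∀ t, HasDerivAt P (-A t + γ • P t) t := by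
    intro t
    have hc : Continuous fun s => -A s + γ • P s := hA.neg.add (hP.const_smul γ)
    exact ((intervalIntegral.integral_hasDerivAt_right (hc.intervalIntegrable T t)
      hc.stronglyMeasurable.stronglyMeasurableAtFilter hc.continuousAt).const_add
        (P T)).congr_of_eventuallyEq (Eventually.of_forall hPA)
  have hqm : StronglyMeasurable fun s => -(P s ∘L J s) := by
    have hc : Continuous fun p : (X →L[ℝ] ℝ) × (X →L[ℝ] X) => -(p.1 ∘L p.2) :=
      (continuous_fst.clm_comp continuous_snd).neg
    exact hc.comp_stronglyMeasurable (hP.stronglyMeasurable.prodMk hJm)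
  have hbound : ∀ a b, a ≤ b → ∃ C : NNReal, ∀ s ∈ Icc a b, ‖-(P s ∘L J s)‖ ≤ C := by
    intro a b hab
    obtain ⟨C, hC⟩ := isCompact_Icc.exists_bound_of_continuousOn (hP.continuousOn (s := Icc a b))
    refine ⟨(C * K).toNNReal, fun s hs => ?_⟩
    rw [norm_neg]
    exact ((P s).opNorm_comp_le (J s)).trans ((mul_le_mul (hC s hs) (hJ s) (norm_nonneg _)
      ((norm_nonneg _).trans (hC s hs))).trans (Real.le_coe_toNNReal _))
  have hint : ∀ a b, a ≤ b → IntegrableOn (fun s => -(P s ∘L J s)) (Icc a b) := by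
    intro a b hab
    obtain ⟨C, hC⟩ := hbound a b hab
    exact Integrable.of_bound hqm.aestronglyMeasurable C ((ae_restrict_iff' measurableSet_Icc).2
      (Eventually.of_forall hC))
  refine ⟨hPd, ?_, fun hJc t => ?_, fun a b hab => ?_, fun a b hab => ?_⟩
  · have hloc : LocallyIntegrable fun s => -(P s ∘L J s) := fun x =>
      ⟨Icc (x - 1) (x + 1), Icc_mem_nhds (by linarith) (by linarith), hint _ _ (by linarith)⟩
    filter_upwards [LocallyIntegrable.ae_hasDerivAt_integral hloc] with t ht
    exact ((ht T).const_add (A T)).congr_of_eventuallyEq (Eventually.of_forall hAJ)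
  · have hc : Continuous fun s => -(P s ∘L J s) := (hP.clm_comp hJc).neg
    exact ((intervalIntegral.integral_hasDerivAt_right (hc.intervalIntegrable T t)
      hc.stronglyMeasurable.stronglyMeasurableAtFilter hc.continuousAt).const_add
        (A T)).congr_of_eventuallyEq (Eventually.of_forall hAJ)
  -- The interval is enlarged to contain `T`, the base point of the primitive.
  · have hab' : min a T ≤ max b T := (min_le_right _ _).trans (le_max_right _ _)
    obtain ⟨C, hC⟩ := hbound _ _ hab'
    refine ⟨C, LipschitzOnWith.mono (t := Icc (min a T) (max b T)) ?_
      (Icc_subset_Icc (min_le_left _ _) (le_max_left _ _))⟩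
    have h1 := lipschitzOnWith_primitive (c := T) ⟨min_le_right _ _, le_max_right _ _⟩
      (hint _ _ hab') hC
    rw [funext hAJ]
    simpa using (LipschitzWith.const (A T)).lipschitzOnWith.add h1
  · obtain ⟨C, hC⟩ := isCompact_Icc.exists_bound_of_continuousOn
      ((hA.neg.add (hP.const_smul γ)).continuousOn (s := Icc a b))
    exact ⟨C.toNNReal, (convex_Icc a b).lipschitzOnWith_of_nnnorm_hasDerivWithin_le
      (fun t _ => (hPd t).hasDerivWithinAt) fun t ht => by
        rw [← norm_toNNReal]
        exact Real.toNNReal_le_toNNReal (hC t ht)⟩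

theorem HasDerivWithinAt.of_eqOn_Icc {E : Type*} [NormedAddCommGroup E] [NormedSpace ℝ E]
    {g G : ℝ → E} {g' : E} {a b t : ℝ} (hg : HasDerivAt G g' t) (h : EqOn g G (Icc a b))
    (ht : t ∈ Icc a b) : HasDerivWithinAt g g' (Icc a b) t :=
  hg.hasDerivWithinAt.congr h (h ht)

theorem LipschitzOnWith.of_eqOn {E E' : Type*} [PseudoEMetricSpace E] [PseudoEMetricSpace E']
    {g G : E → E'} {s : Set E} {K : NNReal} (hG : LipschitzOnWith K G s) (h : EqOn g G s) :
    LipschitzOnWith K g s := fun x hx y hy => by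
  rw [h hx, h hy]
  exact hG hx hy

theorem proposition2 {N : ℕ} {Θ : Type*}
    (f : EuclideanSpace ℝ (Fin N) → ℝ → Θ → EuclideanSpace ℝ (Fin N)) (γ : ℝ) (θ : Θ)
    (t₀ T : ℝ) (hT : t₀ < T)
    (h m : ℝ → EuclideanSpace ℝ (Fin N)) (hsol : IsHBSolution f γ θ t₀ T h m)
    (L : EuclideanSpace ℝ (Fin N) × EuclideanSpace ℝ (Fin N) → ℝ)
    (hL : DifferentiableAt ℝ L (h T, m T)) :
    -- the continuously differentiable case: the equations hold at every time
    (IsC1Field f θ t₀ T →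
      AdjointWellDefined f γ θ t₀ T L h m ∧
      ∀ t ∈ Icc t₀ T,
        HasDerivWithinAt (adjointH f γ θ T L h m)
          (-(adjointM f γ θ T L h m t ∘L jacH f θ (h t) t)) (Icc t₀ T) t ∧
        HasDerivWithinAt (adjointM f γ θ T L h m)
          (-adjointH f γ θ T L h m t + γ • adjointM f γ θ T L h m t) (Icc t₀ T) t ∧
        HasDerivWithinAt (adjointM f γ θ T L h m)
          (adjointMDot f γ θ t₀ T L h m t) (Icc t₀ T) t ∧
        HasDerivWithinAt (adjointMDot f γ θ t₀ T L h m)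
          (adjointM f γ θ T L h m t ∘L jacH f θ (h t) t + γ • adjointMDot f γ θ t₀ T L h m t)
          (Icc t₀ T) t ∧
        adjointH f γ θ T L h m t =
          γ • adjointM f γ θ T L h m t - adjointMDot f γ θ t₀ T L h m t) ∧
    -- the Lipschitz case: the equations that contain `∂f/∂h` hold at almost every time
    (IsLipschitzField f θ t₀ T →
      (∀ᵐ t ∂(volume.restrict (Icc t₀ T)), DifferentiableAt ℝ (fun y => f y t θ) (h t)) →
      AdjointWellDefined f γ θ t₀ T L h m ∧
      (∃ K : NNReal, LipschitzOnWith K (adjointH f γ θ T L h m) (Icc t₀ T)) ∧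
      (∃ K : NNReal, LipschitzOnWith K (adjointM f γ θ T L h m) (Icc t₀ T)) ∧
      (∃ K : NNReal, LipschitzOnWith K (adjointMDot f γ θ t₀ T L h m) (Icc t₀ T)) ∧
      (∀ᵐ t ∂(volume.restrict (Icc t₀ T)),
        HasDerivAt (adjointH f γ θ T L h m)
          (-(adjointM f γ θ T L h m t ∘L jacH f θ (h t) t)) t ∧
        HasDerivAt (adjointMDot f γ θ t₀ T L h m)
          (adjointM f γ θ T L h m t ∘L jacH f θ (h t) t + γ • adjointMDot f γ θ t₀ T L h m t) t) ∧
      ∀ t ∈ Icc t₀ T,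
        HasDerivWithinAt (adjointM f γ θ T L h m)
          (-adjointH f γ θ T L h m t + γ • adjointM f γ θ T L h m t) (Icc t₀ T) t ∧
        HasDerivWithinAt (adjointM f γ θ T L h m)
          (adjointMDot f γ θ t₀ T L h m t) (Icc t₀ T) t ∧
        adjointH f γ θ T L h m t =
          γ • adjointM f γ θ T L h m t - adjointMDot f γ θ t₀ T L h m t) := by
  have hle : t₀ ≤ T := hT.le
  have hJeq : ∀ t ∈ Icc t₀ T, jacAlong f θ hle h t = jacH f θ (h t) t := fun t ht => by
    rw [jacAlong, projIcc_of_mem hle ht]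
  -- The adjoint states are replaced by functions `A`, `P` on the whole line with two-sided
  -- derivatives. Since `t₀ < T`, derivatives within `[t₀, T]` are unique, which identifies
  -- `adjointMDot` with `-A + γ • P`.
  have key : IsLipschitzField f θ t₀ T →
      (∀ᵐ t ∂(volume.restrict (Icc t₀ T)), DifferentiableAt ℝ (fun y => f y t θ) (h t)) →
      AdjointWellDefined f γ θ t₀ T L h m ∧ ∃ A P : ℝ → EuclideanSpace ℝ (Fin N) →L[ℝ] ℝ,
        EqOn (adjointH f γ θ T L h m) A (Icc t₀ T) ∧
        EqOn (adjointM f γ θ T L h m) P (Icc t₀ T) ∧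
        EqOn (adjointMDot f γ θ t₀ T L h m) (fun t => -A t + γ • P t) (Icc t₀ T) ∧
        (∀ t, HasDerivAt P (-A t + γ • P t) t) ∧
        (∀ᵐ t, HasDerivAt A (-(P t ∘L jacAlong f θ hle h t)) t) ∧
        (Continuous (jacAlong f θ hle h) →
          ∀ t, HasDerivAt A (-(P t ∘L jacAlong f θ hle h t)) t) ∧
        (∃ K, LipschitzOnWith K A (Icc t₀ T)) ∧ ∃ K, LipschitzOnWith K P (Icc t₀ T) := by
    intro hf hd
    obtain ⟨hwd, A, P, hA, hP, hHA, hMP, hAJ, hPA⟩ := hf.exists_adjoint hle hsol hd hL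
    obtain ⟨K, hK⟩ := hf.exists_norm_jacAlong_le hle hsol.continuousOn
    obtain ⟨h1, h2, h3, h4, h5⟩ := adjoint_regularity
      (hf.stronglyMeasurable_jacAlong hle hsol.continuousOn) hK hA hP hAJ hPA
    exact ⟨hwd, A, P, hHA, hMP, fun t ht => (HasDerivWithinAt.of_eqOn_Icc (h1 t) hMP ht).derivWithin
      (uniqueDiffOn_Icc hT t ht), h1, h2, h3, h4 _ _ hle, h5 _ _ hle⟩
  have hdot : ∀ {A P : ℝ → EuclideanSpace ℝ (Fin N) →L[ℝ] ℝ} {t : ℝ}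
      {J : EuclideanSpace ℝ (Fin N) →L[ℝ] EuclideanSpace ℝ (Fin N)},
      HasDerivAt P (-A t + γ • P t) t → HasDerivAt A (-(P t ∘L J)) t →
      HasDerivAt (fun t => -A t + γ • P t) (P t ∘L J + γ • (-A t + γ • P t)) t := by
    intro A P t J h1 h2
    simpa only [neg_neg] using! h2.neg.add (h1.const_smul γ)
  constructor
  · intro hf
    obtain ⟨hwd, A, P, hHA, hMP, hDot, hPd, -, hAd, -, -⟩ := key hf.isLipschitzField
      ((ae_restrict_iff' measurableSet_Icc).2 (Eventually.of_forall fun t ht => hf.2.1 _ t ht))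
    refine ⟨hwd, fun t ht => ?_⟩
    have hAt := hAd (hf.continuous_jacAlong hle hsol.continuousOn) t
    rw [hJeq t ht] at hAt
    rw [hHA ht, hMP ht, hDot ht]
    exact ⟨HasDerivWithinAt.of_eqOn_Icc hAt hHA ht, HasDerivWithinAt.of_eqOn_Icc (hPd t) hMP ht,
      HasDerivWithinAt.of_eqOn_Icc (hPd t) hMP ht,
      HasDerivWithinAt.of_eqOn_Icc (hdot (hPd t) hAt) hDot ht, by simp⟩
  · intro hf hd
    obtain ⟨hwd, A, P, hHA, hMP, hDot, hPd, hAd, -, ⟨KA, hKA⟩, ⟨KP, hKP⟩⟩ := key hf hd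
    refine ⟨hwd, ⟨KA, hKA.of_eqOn hHA⟩, ⟨KP, hKP.of_eqOn hMP⟩, ⟨KA + ‖γ‖₊ * KP, ?_⟩, ?_,
      fun t ht => ?_⟩
    · exact (hKA.neg.add ((lipschitzWith_smul γ).lipschitzOnWith.comp hKP
        (mapsTo_univ _ _))).of_eqOn hDot
    · rw [ae_restrict_iff' measurableSet_Icc]
      -- Agreement with `A` and `P` is known on `[t₀, T]` only, so two-sided derivatives transfer at
      -- interior times.
      have hne₀ : ∀ᵐ t : ℝ, t ≠ t₀ := by simp [ae_iff, measure_singleton]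
      have hneT : ∀ᵐ t : ℝ, t ≠ T := by simp [ae_iff, measure_singleton]
      filter_upwards [hAd, hne₀, hneT] with t hAt h1 h2 ht
      have hnhds : Icc t₀ T ∈ 𝓝 t :=
        Icc_mem_nhds (lt_of_le_of_ne ht.1 (Ne.symm h1)) (lt_of_le_of_ne ht.2 h2)
      rw [hJeq t ht] at hAt
      rw [hMP ht, hDot ht]
      exact ⟨(HasDerivWithinAt.of_eqOn_Icc hAt hHA ht).hasDerivAt hnhds,
        (HasDerivWithinAt.of_eqOn_Icc (hdot (hPd t) hAt) hDot ht).hasDerivAt hnhds⟩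
    · rw [hHA ht, hMP ht, hDot ht]
      exact ⟨HasDerivWithinAt.of_eqOn_Icc (hPd t) hMP ht,
        HasDerivWithinAt.of_eqOn_Icc (hPd t) hMP ht, by simp⟩
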